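/- Let $G$ be a (finite-dimensional, real) Lie group with Lie algebra $\mathfrak g=T_1G$, and let $g$ be a left-invariant semi-Riemannian metric on $G$, that is, a left-invariant smooth field of nondegenerate symmetric bilinear forms on the tangent spaces. For $x\in\mathfrak g$ let $\mathrm{ad}_x^\dagger$ be the adjoint of $\mathrm{ad}_x=[x,\cdot\,]$ with respect to $g_1$. Suppose that the Euler–Arnold equation $\dot x=\mathrm{ad}_x^\dagger x$ of $g$ has an idempotent, i.e. an $x_0\in\mathfrak g$ with $x_0\neq 0$ and $\mathrm{ad}_{x_0}^\dagger x_0=x_0$. Then $\mathrm{ad}_{x_0}$ has the eigenvalue $1$, and $G$ has exponential growth along the curve $p(t)=\exp(tx_0)$ in the following sense. Let $g_R$ be any left-invariant Riemannian metric on $G$, with induced norm $\|\cdot\|$ on $\mathfrak g$ and induced distance $d_R$. Then $d_R(1,p(t))$ is finite for all $t\in\mathbb R$, $d_R(1,p(t))\to\infty$ as $t\to\infty$, and for every $y_0\in\mathfrak g$ with $[x_0,y_0]=y_0$ and every $t\ge 0$, $$\|\mathrm{Ad}_{p(t)}\,y_0\|\;\ge\; e^{\,d_R(1,p(t))/\|x_0\|}\;\|y_0\|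 .$$ In particular, if $g_R$ is normalized so that $\|x_0\|=1$, then $\|\mathrm{Ad}_{p(t)}\,y_0\|\ge e^{d_R(1,p(t))}\|y_0\|$ for all $t\ge 0$. -/

import Mathlib

open scoped Manifold ContDiff Bundle
open Filter Topology

noncomputable section

/-- A smooth Lie group is in particular of the regularity that Mathlib uses to define the
Lie algebra structure on the tangent space at the identity. -/
instance LieGroup.minSmoothness_three_of_infty
    {E : Type*} [NormedAddCommGroup E] [NormedSpace ℝ E]
    {G : Type*} [TopologicalSpace G] [ChartedSpace E G] [Group G] [h : LieGroup 𝓘(ℝ, E) ∞ G] :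
    LieGroup 𝓘(ℝ, E) (minSmoothness ℝ 3) G :=
  LieGroup.of_le (n := ∞) (by
    rw [minSmoothness_of_isRCLikeNormedField]
    exact WithTop.coe_le_coe.2 le_top)

section SemiRiemannian

variable (E : Type*) [NormedAddCommGroup E] [NormedSpace ℝ E]
  (M : Type*) [TopologicalSpace M] [ChartedSpace E M] [IsManifold 𝓘(ℝ, E) ∞ M]

/-- A semi-Riemannian metric: a smooth field of nondegenerate symmetric bilinear forms on the
tangent spaces, of any signature. (Constancy of the index is automatic on connected manifolds and
for left-invariant metrics on Lie groups.) -/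
structure SemiRiemannianMetric where
  /-- The pseudo-scalar product on each tangent space. -/
  inner (p : M) : TangentSpace 𝓘(ℝ, E) p →L[ℝ] TangentSpace 𝓘(ℝ, E) p →L[ℝ] ℝ
  symm (p : M) (u v : TangentSpace 𝓘(ℝ, E) p) : inner p u v = inner p v u
  nondegenerate (p : M) (u : TangentSpace 𝓘(ℝ, E) p) (hu : ∀ v, inner p u v = 0) : u = 0
  contMDiff : ContMDiff 𝓘(ℝ, E) (𝓘(ℝ, E).prod 𝓘(ℝ, E →L[ℝ] E →L[ℝ] ℝ)) ∞
    (fun p ↦ Bundle.TotalSpace.mk' (E →L[ℝ] E →L[ℝ] ℝ)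
      (E := fun p : M ↦ (TangentSpace 𝓘(ℝ, E) p →L[ℝ] TangentSpace 𝓘(ℝ, E) p →L[ℝ] ℝ))
      p (inner p))

/-- A smooth Riemannian metric on the manifold `M`. -/
abbrev SmoothRiemannianMetric : Type _ :=
  Bundle.ContMDiffRiemannianMetric 𝓘(ℝ, E) ∞ E (fun p : M ↦ TangentSpace 𝓘(ℝ, E) p)

end SemiRiemannian

variable {E : Type*} [NormedAddCommGroup E] [NormedSpace ℝ E]
  {G : Type*} [TopologicalSpace G] [ChartedSpace E G] [Group G]

/-- A field of bilinear forms on the tangent spaces of a Lie group is left-invariant if all left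
translations `q ↦ a * q` preserve it. -/
def IsLeftInvariantForm
    (b : ∀ p : G, TangentSpace 𝓘(ℝ, E) p →L[ℝ] TangentSpace 𝓘(ℝ, E) p →L[ℝ] ℝ) : Prop :=
  ∀ (a p : G) (u v : TangentSpace 𝓘(ℝ, E) p),
    b (a * p) (mfderiv 𝓘(ℝ, E) 𝓘(ℝ, E) (fun q : G ↦ a * q) p u)
      (mfderiv 𝓘(ℝ, E) 𝓘(ℝ, E) (fun q : G ↦ a * q) p v) = b p u v

/-- The adjoint action `Ad p` on the Lie algebra: the derivative at `1` of the conjugation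
`q ↦ p * q * p⁻¹`. (The tangent spaces at `p * 1 * p⁻¹` and at `1` are the same.) -/
def lieAd (p : G) : GroupLieAlgebra 𝓘(ℝ, E) G →L[ℝ] GroupLieAlgebra 𝓘(ℝ, E) G :=
  mfderiv 𝓘(ℝ, E) 𝓘(ℝ, E) (fun q : G ↦ p * q * p⁻¹) 1

/-- `p` is the curve `t ↦ exp (t x)`: the integral curve of the left-invariant vector field
generated by `x` that starts at the identity. -/
def IsExpCurve (x : GroupLieAlgebra 𝓘(ℝ, E) G) (p : ℝ → G) : Prop :=
  p 0 = 1 ∧ IsMIntegralCurve (I := 𝓘(ℝ, E)) p (mulInvariantVectorField x)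

section Smooth

variable [LieGroup 𝓘(ℝ, E) ∞ G]

namespace SemiRiemannianMetric

/-- The pseudo-scalar product `g₁` on the Lie algebra. -/
def formAtOne (g : SemiRiemannianMetric E G) :
    LinearMap.BilinForm ℝ (GroupLieAlgebra 𝓘(ℝ, E) G) :=
  LinearMap.mk₂ ℝ (fun u v ↦ g.inner 1 u v) (by simp) (by simp) (by simp) (by simp)

theorem formAtOne_nondegenerate (g : SemiRiemannianMetric E G) : g.formAtOne.Nondegenerate :=
  ⟨fun u hu ↦ g.nondegenerate 1 u hu, fun u hu ↦ g.nondegenerate 1 u fun v ↦ by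
    rw [g.symm]; exact hu v⟩

variable [FiniteDimensional ℝ E]

instance : FiniteDimensional ℝ (GroupLieAlgebra 𝓘(ℝ, E) G) :=
  inferInstanceAs (FiniteDimensional ℝ E)

/-- The operator `ad†_x`: the adjoint of `ad x = ⁅x, ·⁆` with respect to `g₁`. -/
def adDagger (g : SemiRiemannianMetric E G) (x : GroupLieAlgebra 𝓘(ℝ, E) G) :
    GroupLieAlgebra 𝓘(ℝ, E) G →ₗ[ℝ] GroupLieAlgebra 𝓘(ℝ, E) G :=
  g.formAtOne.leftAdjointOfNondegenerate g.formAtOne_nondegenerate (LieAlgebra.ad ℝ _ x)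

theorem inner_adDagger (g : SemiRiemannianMetric E G) (x u v : GroupLieAlgebra 𝓘(ℝ, E) G) :
    g.inner 1 (g.adDagger x u) v = g.inner 1 u ⁅x, v⁆ :=
  LinearMap.BilinForm.isAdjointPairLeftAdjointOfNondegenerate g.formAtOne
    g.formAtOne_nondegenerate (LieAlgebra.ad ℝ _ x) u v

/-- `x` is an idempotent of the Euler-Arnold equation `ẋ = ad†_x x` of `g`. -/
def IsEulerArnoldIdempotent (g : SemiRiemannianMetric E G) (x : GroupLieAlgebra 𝓘(ℝ, E) G) :
    Prop :=
  x ≠ 0 ∧ g.adDagger x x = x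

end SemiRiemannianMetric

/-- The norm on the Lie algebra of the scalar product that a Riemannian metric induces there. -/
def normAtOne (gR : SmoothRiemannianMetric E G) (u : GroupLieAlgebra 𝓘(ℝ, E) G) : ℝ :=
  √(gR.inner 1 u u)

/-- The distance `d_R` of a Riemannian metric, with values in `[0, ∞]`: the infimum of the
`g_R`-lengths of the `C¹` curves between two points. -/
def riemDist (gR : SmoothRiemannianMetric E G) (p q : G) : ENNReal :=
  letI : Bundle.RiemannianBundle (fun p : G ↦ TangentSpace 𝓘(ℝ, E) p) := ⟨gR.toRiemannianMetric⟩
  Manifold.riemannianEDist 𝓘(ℝ, E) p q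

end Smooth

end

/-! Pairing the idempotent equation with a vector gives g₁(x₀, v) = g₁(x₀, [x₀, v]), so x₀ is
g₁-orthogonal to the image of ad x₀ - 1. As x₀ ≠ 0 and g₁ is nondegenerate, ad x₀ - 1 is not
surjective, and in finite dimension it has a kernel.

Along p(t) = exp(t x₀) one has (Ad_{p(t)} y)' = Ad_{p(t)} [x₀, y], so [x₀, y] = y forces Ad_{p(t)} y
= eᵗ y (`lieAdModel_expCurve_of_eigenvector`). By left invariance p has constant speed ‖x₀‖, whence
d_R(1, p(t)) ≤ t ‖x₀‖ for t ≥ 0 (`riemDist_expCurve_le`); inserting this into eᵗ gives the growth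
estimate.

For divergence of the distance, choose a linear form ℓ with ℓ(y) ≠ 0 and put h(q) = log(1 + ∑ ℓ(Ad_q
bᵢ)²). Its derivatives along left-invariant fields are bounded uniformly in q, so h is Lipschitz for
d_R, while h(p(t)) ≥ 2t - const.

All of this rests on the derivative of Ad at 1 being the bracket of left-invariant fields
(`fderiv_lieAd_chart`), which is computed from the second derivative of the group law in a chart. -/

noncomputable section

variable {E : Type*} [NormedAddCommGroup E] [NormedSpace ℝ E]
  {G : Type*} [TopologicalSpace G] [ChartedSpace E G] [Group G]

/-! ### The group law in the chart at the identity -/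

/-- The multiplication of a Lie group, read in the preferred chart at the identity. -/
def chartMul (E : Type*) [NormedAddCommGroup E] [NormedSpace ℝ E]
    (G : Type*) [TopologicalSpace G] [ChartedSpace E G] [Group G] (z : E × E) : E :=
  extChartAt 𝓘(ℝ, E) (1 : G)
    ((extChartAt 𝓘(ℝ, E) (1 : G)).symm z.1 * (extChartAt 𝓘(ℝ, E) (1 : G)).symm z.2)

/-- The coordinates of the identity in its preferred chart. -/
def chartOne (E : Type*) [NormedAddCommGroup E] [NormedSpace ℝ E]
    (G : Type*) [TopologicalSpace G] [ChartedSpace E G] [Group G] : E :=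
  extChartAt 𝓘(ℝ, E) (1 : G) 1

/-- The left-invariant vector field generated by `y`, read in the chart at the identity. -/
def chartLeftField (E : Type*) [NormedAddCommGroup E] [NormedSpace ℝ E]
    (G : Type*) [TopologicalSpace G] [ChartedSpace E G] [Group G] (y a : E) : E :=
  fderiv ℝ (chartMul E G) (a, chartOne E G) (0, y)

/-- The derivative at `1` of the right translation by the point with coordinates `a`, read in the
chart at the identity. -/
def chartRightDeriv (E : Type*) [NormedAddCommGroup E] [NormedSpace ℝ E]
    (G : Type*) [TopologicalSpace G] [ChartedSpace E G] [Group G] (a : E) : E →L[ℝ] E :=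
  (fderiv ℝ (chartMul E G) (chartOne E G, a)).comp (ContinuousLinearMap.inl ℝ E E)

theorem chartOne_mem_target : chartOne E G ∈ (extChartAt 𝓘(ℝ, E) (1 : G)).target :=
  mem_extChartAt_target 1

theorem extChartAt_symm_chartOne : (extChartAt 𝓘(ℝ, E) (1 : G)).symm (chartOne E G) = 1 :=
  extChartAt_to_inv 1

theorem eventually_mem_target_chartOne :
    ∀ᶠ a in 𝓝 (chartOne E G), a ∈ (extChartAt 𝓘(ℝ, E) (1 : G)).target :=
  extChartAt_target_mem_nhds 1

theorem chartMul_right_chartOne {a : E} (ha : a ∈ (extChartAt 𝓘(ℝ, E) (1 : G)).target) :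
    chartMul E G (a, chartOne E G) = a := by
  simp only [chartMul, extChartAt_symm_chartOne, mul_one]
  exact (extChartAt 𝓘(ℝ, E) (1 : G)).right_inv ha

theorem chartMul_left_chartOne {a : E} (ha : a ∈ (extChartAt 𝓘(ℝ, E) (1 : G)).target) :
    chartMul E G (chartOne E G, a) = a := by
  simp only [chartMul, extChartAt_symm_chartOne, one_mul]
  exact (extChartAt 𝓘(ℝ, E) (1 : G)).right_inv ha

section
variable [LieGroup 𝓘(ℝ, E) ∞ G]

theorem contMDiffAt_extChartAt_symm_chartOne {a : E}
    (ha : a ∈ (extChartAt 𝓘(ℝ, E) (1 : G)).target) :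
    ContMDiffAt 𝓘(ℝ, E) 𝓘(ℝ, E) ∞ (extChartAt 𝓘(ℝ, E) (1 : G)).symm a :=
  (contMDiffOn_extChartAt_symm (1 : G)).contMDiffAt
    ((isOpen_extChartAt_target (1 : G)).mem_nhds ha)

theorem contDiffAt_chartMul :
    ContDiffAt ℝ ∞ (chartMul E G) (chartOne E G, chartOne E G) := by
  rw [← contMDiffAt_iff_contDiffAt]
  have h := contMDiffAt_extChartAt_symm_chartOne (E := E) (G := G) chartOne_mem_target
  have h1 : ContMDiffAt 𝓘(ℝ, E × E) 𝓘(ℝ, E) ∞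
      (fun z : E × E ↦ (extChartAt 𝓘(ℝ, E) (1 : G)).symm z.1 *
        (extChartAt 𝓘(ℝ, E) (1 : G)).symm z.2) (chartOne E G, chartOne E G) := by
    apply ContMDiffAt.mul (I := 𝓘(ℝ, E))
    · exact ContMDiffAt.comp (I' := 𝓘(ℝ, E)) (chartOne E G, chartOne E G) h
        (contMDiffAt_iff_contDiffAt.2 contDiffAt_fst)
    · exact ContMDiffAt.comp (I' := 𝓘(ℝ, E)) (chartOne E G, chartOne E G) h
        (contMDiffAt_iff_contDiffAt.2 contDiffAt_snd)
  refine ContMDiffAt.comp_of_eq (I' := 𝓘(ℝ, E)) (y := (1 : G)) contMDiffAt_extChartAt h1 ?_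
  simp only [extChartAt_symm_chartOne, mul_one]

theorem eventually_differentiableAt_chartMul :
    ∀ᶠ z in 𝓝 (chartOne E G, chartOne E G), DifferentiableAt ℝ (chartMul E G) z := by
  have h := (contDiffAt_chartMul (E := E) (G := G)).of_le (m := 1) (by simp)
  filter_upwards [h.eventually (by simp)] with z hz using hz.differentiableAt (by simp)

theorem contDiffAt_fderiv_chartMul :
    ContDiffAt ℝ 2 (fderiv ℝ (chartMul E G)) (chartOne E G, chartOne E G) :=
  contDiffAt_chartMul.fderiv_right (by norm_cast)

theorem differentiableAt_fderiv_chartMul :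
    DifferentiableAt ℝ (fderiv ℝ (chartMul E G)) (chartOne E G, chartOne E G) :=
  contDiffAt_fderiv_chartMul.differentiableAt (by simp)

theorem contDiffAt_chartLeftField (y : E) :
    ContDiffAt ℝ 2 (chartLeftField E G y) (chartOne E G) := by
  have h : ContDiffAt ℝ 2 (fun a ↦ fderiv ℝ (chartMul E G) (a, chartOne E G)) (chartOne E G) :=
    ContDiffAt.comp (chartOne E G) contDiffAt_fderiv_chartMul
      (contDiffAt_id.prodMk contDiffAt_const)
  exact h.clm_apply contDiffAt_const

theorem contDiffAt_chartRightDeriv :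
    ContDiffAt ℝ 2 (chartRightDeriv E G) (chartOne E G) := by
  have h : ContDiffAt ℝ 2 (fun a ↦ fderiv ℝ (chartMul E G) (chartOne E G, a)) (chartOne E G) :=
    ContDiffAt.comp (chartOne E G) contDiffAt_fderiv_chartMul
      (contDiffAt_const.prodMk contDiffAt_id)
  exact h.clm_comp contDiffAt_const

theorem fderiv_chartLeftField (x y : E) :
    fderiv ℝ (chartLeftField E G y) (chartOne E G) x =
      fderiv ℝ (fderiv ℝ (chartMul E G)) (chartOne E G, chartOne E G) (x, 0) (0, y) := by
  have h1 : HasFDerivAt (fun a : E ↦ (a, chartOne E G)) (ContinuousLinearMap.inl ℝ E E)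
      (chartOne E G) := hasFDerivAt_prodMk_left _ _
  have h2 := (differentiableAt_fderiv_chartMul (E := E) (G := G)).hasFDerivAt.comp
    (f := fun a : E ↦ (a, chartOne E G)) (chartOne E G) h1
  have h3 := h2.clm_apply (hasFDerivAt_const ((0 : E), y) (chartOne E G))
  have h4 : HasFDerivAt (chartLeftField E G y) _ (chartOne E G) := h3
  rw [h4.fderiv]
  simp

theorem fderiv_chartRightDeriv (x y : E) :
    fderiv ℝ (chartRightDeriv E G) (chartOne E G) x y =
      fderiv ℝ (fderiv ℝ (chartMul E G)) (chartOne E G, chartOne E G) (0, x) (y, 0) := by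
  have h1 : HasFDerivAt (fun a : E ↦ (chartOne E G, a)) (ContinuousLinearMap.inr ℝ E E)
      (chartOne E G) := hasFDerivAt_prodMk_right _ _
  have h2 := (differentiableAt_fderiv_chartMul (E := E) (G := G)).hasFDerivAt.comp
    (chartOne E G) h1
  have h3 := h2.clm_comp
    (hasFDerivAt_const (ContinuousLinearMap.inl ℝ E E) (chartOne E G))
  have h4 : HasFDerivAt (chartRightDeriv E G) _ (chartOne E G) := h3
  rw [h4.fderiv]
  simp

/-- Both sides are the same mixed second derivative of the group law, with its two arguments
exchanged. -/
theorem fderiv_chartRightDeriv_eq_fderiv_chartLeftField (x y : E) :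
    fderiv ℝ (chartRightDeriv E G) (chartOne E G) x y =
      fderiv ℝ (chartLeftField E G x) (chartOne E G) y := by
  rw [fderiv_chartRightDeriv, fderiv_chartLeftField]
  exact (contDiffAt_chartMul.isSymmSndFDerivAt (by simp; norm_cast)) _ _

theorem chartRightDeriv_chartOne :
    chartRightDeriv E G (chartOne E G) = ContinuousLinearMap.id ℝ E := by
  have h1 : HasFDerivAt (fun a : E ↦ (a, chartOne E G)) (ContinuousLinearMap.inl ℝ E E)
      (chartOne E G) := hasFDerivAt_prodMk_left _ _
  have h2 : HasFDerivAt (fun a : E ↦ chartMul E G (a, chartOne E G))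
      (chartRightDeriv E G (chartOne E G)) (chartOne E G) :=
    (contDiffAt_chartMul.differentiableAt (by simp)).hasFDerivAt.comp
      (f := fun a : E ↦ (a, chartOne E G)) (chartOne E G) h1
  refine h2.unique ((hasFDerivAt_id _).congr_of_eventuallyEq ?_)
  filter_upwards [eventually_mem_target_chartOne (E := E) (G := G)] with a ha
    using chartMul_right_chartOne ha

theorem chartLeftField_chartOne (y : E) :
    chartLeftField E G y (chartOne E G) = y := by
  have h1 : HasFDerivAt (fun a : E ↦ (chartOne E G, a)) (ContinuousLinearMap.inr ℝ E E)
      (chartOne E G) := hasFDerivAt_prodMk_right _ _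
  have h2 : HasFDerivAt (fun a : E ↦ chartMul E G (chartOne E G, a)) _ (chartOne E G) :=
    (contDiffAt_chartMul.differentiableAt (by simp)).hasFDerivAt.comp (chartOne E G) h1
  have h3 := h2.unique ((hasFDerivAt_id _).congr_of_eventuallyEq (by
    filter_upwards [eventually_mem_target_chartOne (E := E) (G := G)] with a ha
      using chartMul_left_chartOne ha))
  simpa [chartLeftField] using congrArg (fun T : E →L[ℝ] E ↦ T y) h3

end

/-! ### Translations, conjugations and left-invariant fields on the manifold -/

/-- Chain rule for manifold derivatives, where the intermediate point is only propositionally the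
image of the first one, and derivatives are maps between the model spaces. -/
theorem HasMFDerivAt.comp_of_eq_point {F₁ F₂ M₁ M₂ M₃ : Type*}
    [NormedAddCommGroup F₁] [NormedSpace ℝ F₁] [TopologicalSpace M₁] [ChartedSpace F₁ M₁]
    [NormedAddCommGroup F₂] [NormedSpace ℝ F₂] [TopologicalSpace M₂] [ChartedSpace F₂ M₂]
    [TopologicalSpace M₃] [ChartedSpace E M₃]
    {g : M₂ → M₃} {f : M₁ → M₂} {x : M₁} {y : M₂} {g' : F₂ →L[ℝ] E} {f' : F₁ →L[ℝ] F₂}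
    (hg : HasMFDerivAt 𝓘(ℝ, F₂) 𝓘(ℝ, E) g y g') (hf : HasMFDerivAt 𝓘(ℝ, F₁) 𝓘(ℝ, F₂) f x f')
    (hy : f x = y) : HasMFDerivAt 𝓘(ℝ, F₁) 𝓘(ℝ, E) (g ∘ f) x (g'.comp f') := by
  subst hy
  exact HasMFDerivAt.comp x hg hf

theorem lieAd_apply (p : G) (y : GroupLieAlgebra 𝓘(ℝ, E) G) :
    lieAd p y = mfderiv 𝓘(ℝ, E) 𝓘(ℝ, E) (fun q : G ↦ p * q * p⁻¹) 1 y := rfl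

theorem lieAd_one (y : GroupLieAlgebra 𝓘(ℝ, E) G) : lieAd (1 : G) y = y := by
  have : (fun q : G ↦ (1 : G) * q * 1⁻¹) = id := by ext q; simp
  rw [lieAd_apply, this]
  erw [mfderiv_id]
  rfl

section
variable [LieGroup 𝓘(ℝ, E) ∞ G]

theorem mdifferentiable_mul_left' (a : G) : MDifferentiable 𝓘(ℝ, E) 𝓘(ℝ, E) (fun q : G ↦ a * q) :=
  (contMDiff_mul_left (I := 𝓘(ℝ, E)) (n := ∞)).mdifferentiable (by simp)

theorem contMDiff_conj (p : G) : ContMDiff 𝓘(ℝ, E) 𝓘(ℝ, E) ∞ (fun q : G ↦ p * q * p⁻¹) :=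
  (contMDiff_mul_right (I := 𝓘(ℝ, E)) (n := ∞) (a := p⁻¹)).comp
    (contMDiff_mul_left (I := 𝓘(ℝ, E)) (n := ∞) (a := p))

theorem mdifferentiable_conj (p : G) :
    MDifferentiable 𝓘(ℝ, E) 𝓘(ℝ, E) (fun q : G ↦ p * q * p⁻¹) :=
  (contMDiff_conj p).mdifferentiable (by simp)

theorem lieAd_mul (a b : G) (y : GroupLieAlgebra 𝓘(ℝ, E) G) :
    lieAd (a * b) y = lieAd a (lieAd b y) := by
  have h : (fun q : G ↦ a * b * q * (a * b)⁻¹) =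
      (fun q : G ↦ a * q * a⁻¹) ∘ (fun q : G ↦ b * q * b⁻¹) := by
    ext q; simp [mul_assoc]
  rw [lieAd_apply, h]
  exact mfderiv_comp_apply_of_eq (y := (1 : G)) 1 (mdifferentiable_conj a _)
    (mdifferentiable_conj b _) (by simp) y

theorem mfderiv_mul_left_mulInvariantVectorField (a p : G) (x : GroupLieAlgebra 𝓘(ℝ, E) G) :
    mfderiv 𝓘(ℝ, E) 𝓘(ℝ, E) (fun q : G ↦ a * q) p (mulInvariantVectorField x p) =
      mulInvariantVectorField x (a * p) := by
  have h : (fun q : G ↦ a * p * q) = (fun q : G ↦ a * q) ∘ (fun q : G ↦ p * q) := by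
    ext q; simp [mul_assoc]
  rw [mulInvariantVectorField, mulInvariantVectorField, h]
  exact (mfderiv_comp_apply_of_eq (y := p) 1 (mdifferentiable_mul_left' a _)
    (mdifferentiable_mul_left' p _) (by simp) x).symm

theorem hasMFDerivAt_extChartAt_symm_chartOne :
    HasMFDerivAt 𝓘(ℝ, E) 𝓘(ℝ, E) (extChartAt 𝓘(ℝ, E) (1 : G)).symm (chartOne E G)
      (ContinuousLinearMap.id ℝ E) := by
  have h := mfderivWithin_range_extChartAt_symm (I := 𝓘(ℝ, E)) (x := (1 : G))
  have h2 := ((contMDiffAt_extChartAt_symm_chartOne (E := E) (G := G)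
    chartOne_mem_target).mdifferentiableAt (by simp)).hasMFDerivAt
  simp only [modelWithCornersSelf_coe, Set.range_id, mfderivWithin_univ] at h
  have h' : mfderiv 𝓘(ℝ, E) 𝓘(ℝ, E) (extChartAt 𝓘(ℝ, E) (1 : G)).symm (chartOne E G) =
    ContinuousLinearMap.id ℝ E := h
  rw [h'] at h2
  exact h2

/-- With φ the chart, differentiate b ↦ φ(φ⁻¹(a) φ⁻¹(b)) at the coordinates of 1 in two ways: as a
partial derivative of the group law, and by the chain rule through left translation. -/
theorem mfderiv_extChartAt_mulInvariantVectorField (y : GroupLieAlgebra 𝓘(ℝ, E) G) :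
    ∀ᶠ a in 𝓝 (chartOne E G),
      mfderiv 𝓘(ℝ, E) 𝓘(ℝ, E) (extChartAt 𝓘(ℝ, E) (1 : G))
        ((extChartAt 𝓘(ℝ, E) (1 : G)).symm a)
        (mulInvariantVectorField y ((extChartAt 𝓘(ℝ, E) (1 : G)).symm a)) =
      chartLeftField E G y a := by
  have hc : Tendsto (fun a : E ↦ (a, chartOne E G)) (𝓝 (chartOne E G))
      (𝓝 (chartOne E G, chartOne E G)) :=
    (Continuous.prodMk continuous_id continuous_const).tendsto _
  filter_upwards [eventually_mem_target_chartOne (E := E) (G := G),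
    hc.eventually eventually_differentiableAt_chartMul] with a ha hd
  set φ := extChartAt 𝓘(ℝ, E) (1 : G) with hφ
  have hq : φ.symm a ∈ (chartAt E (1 : G)).source := by
    rw [← extChartAt_source 𝓘(ℝ, E)]; exact φ.map_target ha
  have h1 : HasFDerivAt (fun b : E ↦ (a, b)) (ContinuousLinearMap.inr ℝ E E)
      (chartOne E G) := hasFDerivAt_prodMk_right _ _
  have h2 := hd.hasFDerivAt.comp (f := fun b : E ↦ (a, b)) (chartOne E G) h1
  have h3 : HasMFDerivAt 𝓘(ℝ, E) 𝓘(ℝ, E) (fun b : E ↦ φ.symm a * φ.symm b) (chartOne E G)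
      (mfderiv 𝓘(ℝ, E) 𝓘(ℝ, E) (fun q : G ↦ φ.symm a * q) 1) :=
    HasMFDerivAt.comp_of_eq_point
      (mdifferentiable_mul_left' (φ.symm a) _).hasMFDerivAt
      hasMFDerivAt_extChartAt_symm_chartOne extChartAt_symm_chartOne
  have h4 : HasMFDerivAt 𝓘(ℝ, E) 𝓘(ℝ, E) (fun b : E ↦ φ (φ.symm a * φ.symm b)) (chartOne E G)
      ((mfderiv 𝓘(ℝ, E) 𝓘(ℝ, E) φ (φ.symm a) : E →L[ℝ] E).comp
        (mfderiv 𝓘(ℝ, E) 𝓘(ℝ, E) (fun q : G ↦ φ.symm a * q) 1 : E →L[ℝ] E)) :=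
    HasMFDerivAt.comp_of_eq_point (E := E) (F₁ := E) (F₂ := E)
      (mdifferentiableAt_extChartAt (I := 𝓘(ℝ, E)) hq).hasMFDerivAt h3
      (by simp only [hφ, extChartAt_symm_chartOne, mul_one])
  have h5 := hasMFDerivAt_unique h4 h2.hasMFDerivAt
  simpa [chartLeftField] using! congrArg (fun T : E →L[ℝ] E ↦ T y) h5

end

/-! ### The derivative of Ad is the Lie bracket -/

/-- The adjoint action as an endomorphism of the model space. -/
def lieAdModel (E : Type*) [NormedAddCommGroup E] [NormedSpace ℝ E]
    {G : Type*} [TopologicalSpace G] [ChartedSpace E G] [Group G] (p : G) : E →L[ℝ] E :=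
  lieAd (E := E) p

/-- The Lie bracket of the Lie algebra of `G`, transported to the model space. -/
def modelBracket (E : Type*) [NormedAddCommGroup E] [NormedSpace ℝ E]
    (G : Type*) [TopologicalSpace G] [ChartedSpace E G] [Group G] (x y : E) : E :=
  VectorField.mlieBracket 𝓘(ℝ, E) (mulInvariantVectorField (I := 𝓘(ℝ, E)) (G := G) x)
    (mulInvariantVectorField (I := 𝓘(ℝ, E)) (G := G) y) 1

section
variable [LieGroup 𝓘(ℝ, E) ∞ G]

/-- The bracket is local, so it may be computed as DY·X - DX·Y for the chart readings, whose values
at the identity are x and y. -/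
theorem modelBracket_eq_fderiv_chartLeftField (x y : E) :
    modelBracket E G x y = fderiv ℝ (chartLeftField E G y) (chartOne E G) x -
      fderiv ℝ (chartLeftField E G x) (chartOne E G) y := by
  have key : ∀ z : GroupLieAlgebra 𝓘(ℝ, E) G,
      VectorField.mpullbackWithin 𝓘(ℝ, E) 𝓘(ℝ, E) (extChartAt 𝓘(ℝ, E) (1 : G)).symm
        (mulInvariantVectorField z) (Set.range 𝓘(ℝ, E)) =ᶠ[𝓝 (chartOne E G)]
      chartLeftField E G z := by
    intro z
    filter_upwards [mfderiv_extChartAt_mulInvariantVectorField z,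
      eventually_mem_target_chartOne (E := E) (G := G)] with a ha hat
    rw [VectorField.mpullbackWithin_apply, ← ha]
    refine congrArg (fun T : E →L[ℝ] E ↦ T _) (ContinuousLinearMap.inverse_eq ?_ ?_)
    · exact mfderivWithin_extChartAt_symm_comp_mfderiv_extChartAt hat
    · exact mfderiv_extChartAt_comp_mfderivWithin_extChartAt_symm hat
  rw [modelBracket, ← VectorField.mlieBracketWithin_univ,
    VectorField.mlieBracketWithin_apply, mfderiv_extChartAt_self]
  have hs : ((extChartAt 𝓘(ℝ, E) (1 : G)).symm ⁻¹' Set.univ ∩ Set.range 𝓘(ℝ, E)) = Set.univ := by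
    simp
  rw [hs]
  have h := Filter.EventuallyEq.lieBracketWithin_vectorField_eq_nhds (𝕜 := ℝ) (s := Set.univ)
    (key x) (key y)
  rw [VectorField.lieBracketWithin_univ (V := chartLeftField E G x), VectorField.lieBracket_eq] at h
  simp only [chartLeftField_chartOne] at h
  refine Eq.trans ?_ h
  exact congrArg (fun T : E →L[ℝ] E ↦ T _) ContinuousLinearMap.inverse_id

/-- The derivative of a conjugation, read in the chart at the identity. -/
theorem hasFDerivAt_chart_conj (q : G) :
    HasFDerivAt (fun b : E ↦ extChartAt 𝓘(ℝ, E) (1 : G)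
      (q * (extChartAt 𝓘(ℝ, E) (1 : G)).symm b * q⁻¹)) (lieAdModel E q) (chartOne E G) := by
  have h := ((mdifferentiable_conj (E := E) q (1 : G)).hasMFDerivAt).2
  simp only [writtenInExtChartAt, modelWithCornersSelf_coe, Set.range_id, mul_one,
    mul_inv_cancel] at h
  exact hasFDerivWithinAt_univ.1 h

/-- Differentiate the identity q b = (q b q⁻¹) q with respect to b at 1. -/
theorem chartLeftField_eq_chartRightDeriv_lieAd (y : E) :
    ∀ᶠ a in 𝓝 (chartOne E G), chartLeftField E G y a =
      chartRightDeriv E G a (lieAdModel E ((extChartAt 𝓘(ℝ, E) (1 : G)).symm a) y) := by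
  have hc : Tendsto (fun a : E ↦ (a, chartOne E G)) (𝓝 (chartOne E G))
      (𝓝 (chartOne E G, chartOne E G)) :=
    (Continuous.prodMk continuous_id continuous_const).tendsto _
  have hc' : Tendsto (fun a : E ↦ (chartOne E G, a)) (𝓝 (chartOne E G))
      (𝓝 (chartOne E G, chartOne E G)) :=
    (Continuous.prodMk continuous_const continuous_id).tendsto _
  filter_upwards [eventually_mem_target_chartOne (E := E) (G := G),
    hc.eventually eventually_differentiableAt_chartMul,
    hc'.eventually eventually_differentiableAt_chartMul] with a ha hd hd'
  set φ := extChartAt 𝓘(ℝ, E) (1 : G) with hφ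
  set q := φ.symm a with hq
  have h1 : HasFDerivAt (fun b : E ↦ (a, b)) (ContinuousLinearMap.inr ℝ E E)
      (chartOne E G) := hasFDerivAt_prodMk_right _ _
  have h2 := hd.hasFDerivAt.comp (f := fun b : E ↦ (a, b)) (chartOne E G) h1
  have h3 := (hasFDerivAt_chart_conj (E := E) q).prodMk (hasFDerivAt_const a (chartOne E G))
  have h0 : φ (q * φ.symm (chartOne E G) * q⁻¹) = chartOne E G := by
    rw [extChartAt_symm_chartOne]; simp [hφ, chartOne]
  have hd'' : HasFDerivAt (chartMul E G) (fderiv ℝ (chartMul E G) (chartOne E G, a))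
      (φ (q * φ.symm (chartOne E G) * q⁻¹), a) := by
    rw [h0]; exact hd'.hasFDerivAt
  have h4 := hd''.comp (f := fun b : E ↦ (φ (q * φ.symm b * q⁻¹), a)) (chartOne E G) h3
  have hcont : ContinuousAt (fun b : E ↦ q * φ.symm b * q⁻¹) (chartOne E G) := by
    have : ContinuousAt φ.symm (chartOne E G) :=
      (contMDiffAt_extChartAt_symm_chartOne (G := G) chartOne_mem_target).continuousAt
    exact (contMDiff_conj (E := E) q).continuous.continuousAt.comp this
  have hsrc : ∀ᶠ b in 𝓝 (chartOne E G), q * φ.symm b * q⁻¹ ∈ φ.source := by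
    apply hcont.preimage_mem_nhds
    rw [extChartAt_symm_chartOne]
    simpa [hφ] using extChartAt_source_mem_nhds (I := 𝓘(ℝ, E)) (1 : G)
  have h5 := h4.congr_of_eventuallyEq (f₁ := chartMul E G ∘ fun b : E ↦ (a, b)) (by
    filter_upwards [hsrc] with b hb
    simp only [Function.comp, chartMul]
    rw [← hφ, φ.left_inv hb, ← hq]
    simp)
  have h6 := congrArg (fun T : E →L[ℝ] E ↦ T y) (h2.unique h5)
  simpa [chartLeftField, chartRightDeriv] using! h6

theorem lieAdModel_mul (a b : G) : lieAdModel E (a * b) = (lieAdModel E a).comp (lieAdModel E b) :=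
  ContinuousLinearMap.ext fun y ↦ lieAd_mul a b y

variable [CompleteSpace E]

/-- The right-translation derivative is the identity at 1, hence invertible nearby. Solving for Ad
in this way shows that Ad is differentiable near 1. -/
theorem lieAd_eq_inverse_chartRightDeriv (y : E) :
    ∀ᶠ a in 𝓝 (chartOne E G),
      lieAdModel E ((extChartAt 𝓘(ℝ, E) (1 : G)).symm a) y =
      (chartRightDeriv E G a).inverse (chartLeftField E G y a) := by
  have hu : ∀ᶠ a in 𝓝 (chartOne E G), (chartRightDeriv E G a).IsInvertible := by
    have hc := (contDiffAt_chartRightDeriv (E := E) (G := G)).continuousAt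
    apply hc.eventually (p := ContinuousLinearMap.IsInvertible)
    rw [chartRightDeriv_chartOne]
    exact (ContinuousLinearEquiv.refl ℝ E).nhds
  filter_upwards [hu, chartLeftField_eq_chartRightDeriv_lieAd (G := G) y] with a ha h
  rw [h]
  obtain ⟨e, he⟩ := ha
  simp [← he]

theorem contDiffAt_lieAd_chart (y : E) :
    ContDiffAt ℝ 2 (fun a : E ↦
      lieAdModel E ((extChartAt 𝓘(ℝ, E) (1 : G)).symm a) y) (chartOne E G) := by
  have h1 : ContDiffAt ℝ 2 (fun a ↦ (chartRightDeriv E G a).inverse) (chartOne E G) := by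
    refine ContDiffAt.comp (g := ContinuousLinearMap.inverse) (chartOne E G) ?_
      contDiffAt_chartRightDeriv
    apply ContinuousLinearMap.IsInvertible.contDiffAt_map_inverse (E := E) (F := E)
    rw [chartRightDeriv_chartOne]
    exact ⟨ContinuousLinearEquiv.refl ℝ E, rfl⟩
  exact (h1.clm_apply (contDiffAt_chartLeftField y)).congr_of_eventuallyEq
    (lieAd_eq_inverse_chartRightDeriv y)

/-- Write L_y(a) = R_a (Ad_a y) and differentiate at the identity in the direction x: DL_y(x) =
DR(x) y + D(Ad y)(x). Symmetry of the second derivative turns DR(x) y into DL_x(y), and what remains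
is the coordinate formula for the bracket. -/
theorem fderiv_lieAd_chart (x y : E) :
    fderiv ℝ (fun a : E ↦ lieAdModel E ((extChartAt 𝓘(ℝ, E) (1 : G)).symm a) y)
      (chartOne E G) x = modelBracket E G x y := by
  have h1 := ((contDiffAt_chartRightDeriv (E := E) (G := G)).differentiableAt (by simp)).hasFDerivAt
  have h2 := ((contDiffAt_lieAd_chart (G := G) y).differentiableAt (by simp)).hasFDerivAt
  have h3 := (h1.clm_apply h2).congr_of_eventuallyEq
    (chartLeftField_eq_chartRightDeriv_lieAd (G := G) y)
  have h4 := congrArg (fun T : E →L[ℝ] E ↦ T x) h3.fderiv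
  have h5 : lieAdModel E (1 : G) y = y := lieAd_one y
  simp only [chartRightDeriv_chartOne, extChartAt_symm_chartOne, h5] at h4
  rw [modelBracket_eq_fderiv_chartLeftField, ← fderiv_chartRightDeriv_eq_fderiv_chartLeftField x y]
  refine eq_sub_of_add_eq ?_
  simpa using! h4.symm

theorem contMDiff_lieAdModel (y : E) :
    ContMDiff 𝓘(ℝ, E) 𝓘(ℝ, E) 2 (fun q : G ↦ lieAdModel E q y) := by
  have h1 : ContMDiffAt 𝓘(ℝ, E) 𝓘(ℝ, E) 2 (fun q : G ↦ lieAdModel E q y) 1 := by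
    have h := ContMDiffAt.comp (I' := 𝓘(ℝ, E)) (1 : G)
      (contMDiffAt_iff_contDiffAt.2 (contDiffAt_lieAd_chart (G := G) y))
      (contMDiffAt_extChartAt (n := 2))
    refine h.congr_of_eventuallyEq ?_
    filter_upwards [extChartAt_source_mem_nhds (I := 𝓘(ℝ, E)) (1 : G)] with q hq
    simp only [Function.comp]
    rw [(extChartAt 𝓘(ℝ, E) (1 : G)).left_inv hq]
  -- Smoothness at 1 spreads to every q through Ad_p = Ad_q Ad_{q⁻¹p}.
  intro q
  have h2 : ContMDiffAt 𝓘(ℝ, E) 𝓘(ℝ, E) 2 (fun p : G ↦ lieAdModel E (q⁻¹ * p) y) q :=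
    ContMDiffAt.comp_of_eq (I' := 𝓘(ℝ, E)) h1
      ((contMDiff_mul_left (I := 𝓘(ℝ, E)) (n := ∞) (a := q⁻¹)).of_le (by norm_cast)).contMDiffAt
      (by simp)
  have h3 := ContMDiffAt.comp q (lieAdModel E q).contMDiff.contMDiffAt h2
  convert! h3 using 2 with p
  rw [Function.comp, ← ContinuousLinearMap.comp_apply, ← lieAdModel_mul, mul_inv_cancel_left]

theorem mfderiv_lieAdModel_one (x y : E) :
    (mfderiv 𝓘(ℝ, E) 𝓘(ℝ, E) (fun q : G ↦ lieAdModel E q y) 1 : E →L[ℝ] E) x = modelBracket E G x y := by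
  rw [← fderiv_lieAd_chart]
  have h1 := ((contMDiff_lieAdModel (G := G) y).mdifferentiable (by simp) 1).hasMFDerivAt
  have h2 := HasMFDerivAt.comp_of_eq_point (E := E) (F₁ := E) (F₂ := E) h1
    hasMFDerivAt_extChartAt_symm_chartOne extChartAt_symm_chartOne
  have h3 := h2.mfderiv
  rw [mfderiv_eq_fderiv] at h3
  exact (congrArg (fun T : E →L[ℝ] E ↦ T x) h3).symm

/-- Differentiate Ad_{qp} y = Ad_q (Ad_p y) in p at 1. -/
theorem mfderiv_lieAdModel_mulInvariantVectorField (x y : E) (q : G) :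
    (mfderiv 𝓘(ℝ, E) 𝓘(ℝ, E) (fun q : G ↦ lieAdModel E q y) q : E →L[ℝ] E)
      (mulInvariantVectorField x q) = lieAdModel E q (modelBracket E G x y) := by
  have h (p : G) := ((contMDiff_lieAdModel (G := G) y).mdifferentiable (by simp) p).hasMFDerivAt
  have h2 := HasMFDerivAt.comp_of_eq_point (E := E) (F₁ := E) (F₂ := E) (h q)
    (mdifferentiable_mul_left' (E := E) q 1).hasMFDerivAt (mul_one q)
  have h3 := HasMFDerivAt.comp_of_eq_point (E := E) (F₁ := E) (F₂ := E)
    (lieAdModel E q).hasMFDerivAt (h 1) rfl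
  have h4 : (fun p : G ↦ lieAdModel E p y) ∘ (fun p : G ↦ q * p) =
      lieAdModel E q ∘ (fun p : G ↦ lieAdModel E p y) := by
    ext p; simp [lieAdModel_mul]
  rw [h4] at h2
  have h5 := congrArg (fun T : E →L[ℝ] E ↦ T x) (hasMFDerivAt_unique h2 h3)
  rw [← mfderiv_lieAdModel_one]
  exact h5

end

/-! ### Exponential curves and Ad along them -/

/-- Integral curves of a continuous vector field on a boundaryless manifold are `C¹`. -/
theorem IsMIntegralCurve.contMDiff_one {M : Type*} [TopologicalSpace M] [ChartedSpace E M]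
    [IsManifold 𝓘(ℝ, E) 1 M] {v : (x : M) → TangentSpace 𝓘(ℝ, E) x}
    (hv : Continuous (fun x ↦ (⟨x, v x⟩ : TangentBundle 𝓘(ℝ, E) M))) {γ : ℝ → M}
    (hγ : IsMIntegralCurve (I := 𝓘(ℝ, E)) γ v) : ContMDiff 𝓘(ℝ, ℝ) 𝓘(ℝ, E) 1 γ := by
  intro t₀
  rw [contMDiffAt_iff_target]
  refine ⟨hγ.continuous.continuousAt, ?_⟩
  rw [contMDiffAt_iff_contDiffAt, contDiffAt_one_iff]
  -- The derivative of the chart reading of γ is the fibre coordinate of v along γ, which is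
  -- continuous because v and γ are.
  set e := trivializationAt E (TangentSpace 𝓘(ℝ, E) : M → Type _) (γ t₀) with he
  have hcont : ContinuousOn (fun t ↦ (e ⟨γ t, v (γ t)⟩).2) (γ ⁻¹' (chartAt E (γ t₀)).source) := by
    refine continuous_snd.comp_continuousOn (e.continuousOn.comp
      (hv.comp hγ.continuous).continuousOn ?_)
    intro t ht
    rw [e.mem_source]
    simpa [he] using ht
  have hsrc : γ ⁻¹' (chartAt E (γ t₀)).source ∈ 𝓝 t₀ :=
    hγ.continuous.continuousAt.preimage_mem_nhds (chart_source_mem_nhds E (γ t₀))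
  obtain ⟨u, hu, hd⟩ := (hγ.isMIntegralCurveAt t₀).eventually_hasDerivAt.exists_mem
  refine ⟨fun t ↦ (1 : ℝ →L[ℝ] ℝ).smulRight (e ⟨γ t, v (γ t)⟩).2, _, inter_mem hu hsrc, ?_, ?_⟩
  · exact (ContinuousLinearMap.smulRightL ℝ ℝ E 1).continuous.comp_continuousOn
      (hcont.mono Set.inter_subset_right)
  · intro t ht
    exact (hd t ht.1).hasFDerivAt

section
variable [LieGroup 𝓘(ℝ, E) ∞ G]

theorem contMDiff_one_mulInvariantVectorField (x : GroupLieAlgebra 𝓘(ℝ, E) G) :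
    ContMDiff 𝓘(ℝ, E) 𝓘(ℝ, E).tangent 1
      (fun q : G ↦ (⟨q, mulInvariantVectorField x q⟩ : TangentBundle 𝓘(ℝ, E) G)) :=
  (contMDiff_mulInvariantVectorField x).of_le (by
    rw [minSmoothness_of_isRCLikeNormedField]; norm_num)

/-- Left translates of integral curves of a left-invariant field are integral curves. -/
theorem IsMIntegralCurveOn.const_mul {x : GroupLieAlgebra 𝓘(ℝ, E) G} {γ : ℝ → G} {s : Set ℝ}
    (hγ : IsMIntegralCurveOn (I := 𝓘(ℝ, E)) γ (mulInvariantVectorField x) s) (a : G) :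
    IsMIntegralCurveOn (I := 𝓘(ℝ, E)) (fun t ↦ a * γ t) (mulInvariantVectorField x) s := by
  intro t ht
  have h := (mdifferentiable_mul_left' (E := E) a (γ t)).hasMFDerivAt.comp_hasMFDerivWithinAt t
    (hγ t ht)
  have key : (1 : ℝ →L[ℝ] ℝ).smulRight (mulInvariantVectorField x (a * γ t) : E) =
      (mfderiv 𝓘(ℝ, E) 𝓘(ℝ, E) (fun q : G ↦ a * q) (γ t) : E →L[ℝ] E).comp
        ((1 : ℝ →L[ℝ] ℝ).smulRight (mulInvariantVectorField x (γ t) : E)) := by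
    rw [← mfderiv_mul_left_mulInvariantVectorField]
    refine ContinuousLinearMap.ext fun r ↦ ?_
    exact ((mfderiv 𝓘(ℝ, E) 𝓘(ℝ, E) (fun q : G ↦ a * q) (γ t) : E →L[ℝ] E).map_smul r _).symm
  exact key ▸ h

/-- A local integral curve through 1 can be left-translated to any point, so the existence time is
uniform over G and the curve extends to all of ℝ. -/
theorem exists_isExpCurve [CompleteSpace E] [T2Space G] (x : GroupLieAlgebra 𝓘(ℝ, E) G) :
    ∃ p : ℝ → G, IsExpCurve x p := by
  have hv := contMDiff_one_mulInvariantVectorField x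
  have : IsManifold 𝓘(ℝ, E) 1 G := IsManifold.of_le (n := ∞) (by norm_cast)
  obtain ⟨γ, h0, hγ⟩ := exists_isMIntegralCurveAt_of_contMDiffAt_boundaryless (I := 𝓘(ℝ, E))
    (t₀ := 0) (hv 1)
  obtain ⟨ε, hε, hγ⟩ := isMIntegralCurveAt_iff'.1 hγ
  rw [Real.ball_eq_Ioo, zero_sub, zero_add] at hγ
  exact exists_isMIntegralCurve_of_isMIntegralCurveOn hv hε
    (fun a ↦ ⟨fun t ↦ a * γ t, by simp [h0], hγ.const_mul a⟩) 1

theorem IsExpCurve.contMDiff {x : GroupLieAlgebra 𝓘(ℝ, E) G} {p : ℝ → G} (hp : IsExpCurve x p) :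
    ContMDiff 𝓘(ℝ, ℝ) 𝓘(ℝ, E) 1 p :=
  have : IsManifold 𝓘(ℝ, E) 1 G := IsManifold.of_le (n := ∞) (by norm_cast)
  hp.2.contMDiff_one (contMDiff_one_mulInvariantVectorField x).continuous

theorem hasDerivAt_lieAdModel_expCurve [CompleteSpace E] {x : E} {p : ℝ → G}
    (hp : IsExpCurve (E := E) x p) (y : E) (t : ℝ) :
    HasDerivAt (fun t ↦ lieAdModel E (p t) y) (lieAdModel E (p t) (modelBracket E G x y)) t := by
  let D : E →L[ℝ] E := mfderiv 𝓘(ℝ, E) 𝓘(ℝ, E) (fun q : G ↦ lieAdModel E q y) (p t)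
  let X : E := mulInvariantVectorField (I := 𝓘(ℝ, E)) x (p t)
  have h1 : HasMFDerivAt 𝓘(ℝ, E) 𝓘(ℝ, E) (fun q : G ↦ lieAdModel E q y) (p t) D :=
    ((contMDiff_lieAdModel (G := G) y).mdifferentiable (by simp) (p t)).hasMFDerivAt
  have hp2 : HasMFDerivAt 𝓘(ℝ, ℝ) 𝓘(ℝ, E) p t ((1 : ℝ →L[ℝ] ℝ).smulRight X) := hp.2 t
  have h2 : HasFDerivAt (fun t ↦ lieAdModel E (p t) y) (D.comp ((1 : ℝ →L[ℝ] ℝ).smulRight X)) t :=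
    hasMFDerivAt_iff_hasFDerivAt.1 (HasMFDerivAt.comp_of_eq_point h1 hp2 rfl)
  have h3 : D X = lieAdModel E (p t) (modelBracket E G x y) :=
    mfderiv_lieAdModel_mulInvariantVectorField x y (p t)
  rw [← h3]
  simpa using h2.hasDerivAt

/-- The curve e⁻ᵗ Ad_{p(t)} y has zero derivative and starts at y. -/
theorem lieAdModel_expCurve_of_eigenvector [CompleteSpace E] {x : E} {p : ℝ → G}
    (hp : IsExpCurve (E := E) x p) {y : E} (hy : modelBracket E G x y = y) (t : ℝ) :
    lieAdModel E (p t) y = Real.exp t • y := by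
  have h (t : ℝ) : HasDerivAt (fun t ↦ Real.exp (-t) • lieAdModel E (p t) y) 0 t := by
    have h1 := ((hasDerivAt_neg t).exp).smul (hasDerivAt_lieAdModel_expCurve hp y t)
    rw [hy] at h1
    convert! h1 using 1
    simp
  have h2 := is_const_of_deriv_eq_zero (fun t ↦ (h t).differentiableAt) (fun t ↦ (h t).deriv) t 0
  have h3 : lieAdModel E (1 : G) y = y := lieAd_one y
  simp only [neg_zero, Real.exp_zero, one_smul, hp.1, h3] at h2
  nth_rw 2 [← h2]
  rw [smul_smul, ← Real.exp_add]
  simp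

end

/-! ### Lengths and distances for left-invariant metrics -/

/-- Left-invariant vector fields have constant length for a left-invariant form. -/
theorem IsLeftInvariantForm.apply_mulInvariantVectorField
    {b : ∀ p : G, TangentSpace 𝓘(ℝ, E) p →L[ℝ] TangentSpace 𝓘(ℝ, E) p →L[ℝ] ℝ}
    (hb : IsLeftInvariantForm b) (q : G) (x y : GroupLieAlgebra 𝓘(ℝ, E) G) :
    b q (mulInvariantVectorField x q) (mulInvariantVectorField y q) = b 1 x y := by
  rw [← hb q 1 x y]
  have h : ∀ r : G, r = q → ∀ u v : E, (b r : E →L[ℝ] E →L[ℝ] ℝ) u v = b q u v := by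
    rintro r rfl u v; rfl
  exact (h (q * 1) (mul_one q) _ _).symm

section
variable [LieGroup 𝓘(ℝ, E) ∞ G]

/-- Left translations are diffeomorphisms. Bounds on a differential therefore need checking on
left-invariant fields only. -/
theorem exists_mulInvariantVectorField_eq (q : G) (v : TangentSpace 𝓘(ℝ, E) q) :
    ∃ ξ : GroupLieAlgebra 𝓘(ℝ, E) G, mulInvariantVectorField ξ q = v := by
  let D : E →L[ℝ] E := mfderiv 𝓘(ℝ, E) 𝓘(ℝ, E) (fun p : G ↦ q⁻¹ * p) q
  let D' : E →L[ℝ] E := mfderiv 𝓘(ℝ, E) 𝓘(ℝ, E) (fun p : G ↦ q * p) 1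
  have h1 : HasMFDerivAt 𝓘(ℝ, E) 𝓘(ℝ, E) (fun p : G ↦ q⁻¹ * p) q D :=
    (mdifferentiable_mul_left' (E := E) q⁻¹ q).hasMFDerivAt
  have h2 : HasMFDerivAt 𝓘(ℝ, E) 𝓘(ℝ, E) (fun p : G ↦ q * p) 1 D' :=
    (mdifferentiable_mul_left' (E := E) q 1).hasMFDerivAt
  have h3 := HasMFDerivAt.comp_of_eq_point h2 h1 (inv_mul_cancel q)
  have h4 : (fun p : G ↦ q * p) ∘ (fun p : G ↦ q⁻¹ * p) = id := by ext p; simp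
  rw [h4] at h3
  exact ⟨D v, congrArg (fun T : E →L[ℝ] E ↦ T v) (hasMFDerivAt_unique h3 (hasMFDerivAt_id q))⟩

theorem normAtOne_nonneg (gR : SmoothRiemannianMetric E G) (u : GroupLieAlgebra 𝓘(ℝ, E) G) :
    0 ≤ normAtOne gR u := Real.sqrt_nonneg _

theorem normAtOne_pos (gR : SmoothRiemannianMetric E G) {u : GroupLieAlgebra 𝓘(ℝ, E) G}
    (hu : u ≠ 0) : 0 < normAtOne gR u := Real.sqrt_pos.2 (gR.pos 1 u hu)

theorem normAtOne_smul (gR : SmoothRiemannianMetric E G) (c : ℝ)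
    (u : GroupLieAlgebra 𝓘(ℝ, E) G) : normAtOne gR (c • u) = |c| * normAtOne gR u := by
  simp only [normAtOne, map_smul, smul_apply, smul_eq_mul]
  rw [← mul_assoc, Real.sqrt_mul (mul_self_nonneg c), Real.sqrt_mul_self_eq_abs]

theorem exists_norm_le_normAtOne (gR : SmoothRiemannianMetric E G) :
    ∃ K : ℝ, 0 ≤ K ∧ ∀ u : E, ‖u‖ ≤ K * normAtOne gR u := by
  let B : E →L[ℝ] E →L[ℝ] ℝ := gR.inner 1
  have h : Bornology.IsVonNBounded ℝ {v : E | B v v < 1} := gR.isVonNBounded 1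
  obtain ⟨r, hr⟩ := NormedSpace.isVonNBounded_iff' ℝ |>.1 h
  have hr0 : 0 ≤ r := (norm_nonneg _).trans (hr (0 : E) (by simp))
  -- The factor 2 rescales u strictly inside the open unit ball of the metric, where the norm bound
  -- r applies.
  refine ⟨2 * r, by positivity, fun u ↦ ?_⟩
  by_cases hu : u = 0
  · subst hu
    rw [norm_zero]
    exact mul_nonneg (by positivity) (normAtOne_nonneg _ _)
  set N := normAtOne gR u with hN
  have hNpos : 0 < N := normAtOne_pos gR (u := u) hu
  have hN2 : B u u = N ^ 2 := (Real.sq_sqrt (gR.pos 1 u hu).le).symm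
  have h1 := hr ((2 * N)⁻¹ • u) (by
    have : B ((2 * N)⁻¹ • u) ((2 * N)⁻¹ • u) = 1 / 4 := by
      simp only [map_smul, smul_apply, smul_eq_mul, hN2]
      field_simp
      norm_num
    rw [Set.mem_ofPred_eq, this]
    norm_num)
  rw [norm_smul, norm_inv, Real.norm_of_nonneg (by positivity)] at h1
  rw [inv_mul_le_iff₀ (by positivity)] at h1
  linarith

/-- A `C¹` function whose differential is bounded by `C` is `C`-Lipschitz for the Riemannian
distance. -/
theorem abs_sub_le_mul_riemDist (gR : SmoothRiemannianMetric E G) {h : G → ℝ}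
    (hh : ContMDiff 𝓘(ℝ, E) 𝓘(ℝ, ℝ) 1 h) {C : ℝ} (hC : 0 < C)
    (hb : ∀ (q : G) (D : E →L[ℝ] ℝ), HasMFDerivAt 𝓘(ℝ, E) 𝓘(ℝ, ℝ) h q D → ∀ v : E,
      |D v| ≤ C * √((gR.inner q : E →L[ℝ] E →L[ℝ] ℝ) v v))
    {a b : G} (hab : riemDist gR a b ≠ ⊤) : |h b - h a| ≤ C * (riemDist gR a b).toReal := by
  let _ : Bundle.RiemannianBundle (fun p : G ↦ TangentSpace 𝓘(ℝ, E) p) := ⟨gR.toRiemannianMetric⟩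
  have hnorm (q : G) (v : TangentSpace 𝓘(ℝ, E) q) : ‖v‖ = √(gR.inner q v v) := by
    rw [norm_eq_sqrt_real_inner]; rfl
  -- For each r above the distance there is a C¹ curve γ of length below r; integrating |(h ∘ γ)'| ≤
  -- C ‖γ'‖ bounds the increment of h by C r.
  suffices H : ∀ r : ℝ, (riemDist gR a b).toReal < r → |h b - h a| / C ≤ r by
    rw [← div_le_iff₀' hC]
    exact le_of_forall_gt_imp_ge_of_dense H
  intro r hr
  have hlt : Manifold.riemannianEDist 𝓘(ℝ, E) a b < ENNReal.ofReal r := by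
    have := (ENNReal.lt_ofReal_iff_toReal_lt hab).2 hr
    exact this
  obtain ⟨γ, rfl, rfl, hγ, hlen⟩ := Manifold.exists_lt_of_riemannianEDist_lt hlt
  have hD : ContDiffOn ℝ 1 (h ∘ γ) (Set.Icc 0 1) :=
    contMDiffOn_iff_contDiffOn.1 (hh.comp_contMDiffOn hγ)
  have h1 : ‖(h ∘ γ) 1 - (h ∘ γ) 0‖ₑ ≤
      ENNReal.ofReal C * Manifold.pathELength 𝓘(ℝ, E) γ 0 1 := by
    refine (enorm_sub_le_lintegral_derivWithin_Icc_of_contDiffOn_Icc hD zero_le_one).trans ?_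
    rw [Manifold.pathELength_eq_lintegral_mfderivWithin_Icc,
      ← MeasureTheory.lintegral_const_mul' _ _ ENNReal.ofReal_ne_top]
    refine MeasureTheory.setLIntegral_mono' measurableSet_Icc fun t ht ↦ ?_
    have hu : UniqueMDiffWithinAt 𝓘(ℝ, ℝ) (Set.Icc (0 : ℝ) 1) t :=
      (uniqueDiffOn_Icc zero_lt_one t ht).uniqueMDiffWithinAt
    have hc := mfderiv_comp_mfderivWithin t ((hh.mdifferentiable (by simp)) (γ t))
      ((hγ.mdifferentiableOn (by simp)) t ht) hu
    have hd : derivWithin (h ∘ γ) (Set.Icc 0 1) t =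
        mfderiv 𝓘(ℝ, E) 𝓘(ℝ, ℝ) h (γ t)
          (mfderivWithin 𝓘(ℝ, ℝ) 𝓘(ℝ, E) γ (Set.Icc 0 1) t 1) := by
      rw [← fderivWithin_derivWithin, ← mfderivWithin_eq_fderivWithin, hc]
      rfl
    rw [← ofReal_norm, ← ofReal_norm, ← ENNReal.ofReal_mul hC.le, hnorm, hd]
    exact ENNReal.ofReal_le_ofReal (hb _ _ (hh.mdifferentiable (by simp) (γ t)).hasMFDerivAt _)
  have h2 : ‖h (γ 1) - h (γ 0)‖ₑ ≤ ENNReal.ofReal C * ENNReal.ofReal r :=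
    h1.trans (mul_le_mul_right hlen.le _)
  rw [← ofReal_norm, ← ENNReal.ofReal_mul hC.le] at h2
  have hr0 : 0 ≤ r := ENNReal.toReal_nonneg.trans hr.le
  rw [ENNReal.ofReal_le_ofReal_iff (by positivity), Real.norm_eq_abs] at h2
  rwa [div_le_iff₀' hC]

theorem riemDist_comm (gR : SmoothRiemannianMetric E G) (a b : G) :
    riemDist gR a b = riemDist gR b a := by
  let _ : Bundle.RiemannianBundle (fun p : G ↦ TangentSpace 𝓘(ℝ, E) p) := ⟨gR.toRiemannianMetric⟩
  exact Manifold.riemannianEDist_comm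

/-- The velocity of p is a left-invariant field along p, so its speed is constant and the arc from s
to t has length (t - s)‖x‖. -/
theorem riemDist_expCurve_le (gR : SmoothRiemannianMetric E G) (hgR : IsLeftInvariantForm gR.inner)
    {x : GroupLieAlgebra 𝓘(ℝ, E) G} {p : ℝ → G} (hp : IsExpCurve x p) {s t : ℝ} (hst : s ≤ t) :
    riemDist gR (p s) (p t) ≤ ENNReal.ofReal ((t - s) * normAtOne gR x) := by
  let _ : Bundle.RiemannianBundle (fun p : G ↦ TangentSpace 𝓘(ℝ, E) p) := ⟨gR.toRiemannianMetric⟩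
  have hnorm (q : G) (v : TangentSpace 𝓘(ℝ, E) q) : ‖v‖ = √(gR.inner q v v) := by
    rw [norm_eq_sqrt_real_inner]; rfl
  refine (Manifold.riemannianEDist_le_pathELength (γ := p) hp.contMDiff.contMDiffOn rfl rfl
    hst).trans ?_
  have hs (u : ℝ) : ‖mfderiv 𝓘(ℝ, ℝ) 𝓘(ℝ, E) p u 1‖ₑ = ENNReal.ofReal (normAtOne gR x) := by
    have h1 : mfderiv 𝓘(ℝ, ℝ) 𝓘(ℝ, E) p u 1 = mulInvariantVectorField x (p u) := by
      rw [(hp.2 u).mfderiv]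
      exact one_smul ℝ (mulInvariantVectorField x (p u) : E)
    rw [h1, ← ofReal_norm, hnorm, hgR.apply_mulInvariantVectorField]
    rfl
  rw [Manifold.pathELength_eq_lintegral_mfderiv_Icc]
  simp only [hs]
  rw [MeasureTheory.setLIntegral_const, Real.volume_Icc, mul_comm,
    ENNReal.ofReal_mul (sub_nonneg.2 hst)]

theorem riemDist_expCurve_ne_top (gR : SmoothRiemannianMetric E G)
    (hgR : IsLeftInvariantForm gR.inner)
    {x : GroupLieAlgebra 𝓘(ℝ, E) G} {p : ℝ → G} (hp : IsExpCurve x p) (s t : ℝ) :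
    riemDist gR (p s) (p t) ≠ ⊤ := by
  rcases le_total s t with h | h
  · exact ((riemDist_expCurve_le gR hgR hp h).trans_lt ENNReal.ofReal_lt_top).ne
  · rw [riemDist_comm]
    exact ((riemDist_expCurve_le gR hgR hp h).trans_lt ENNReal.ofReal_lt_top).ne

end

/-! ### A Lipschitz function built from Ad, and divergence of the distance -/

theorem Module.Basis.apply_eq_sum_repr_mul {ι : Type*} [Fintype ι] (b : Module.Basis ι ℝ E)
    (T : E →L[ℝ] ℝ) (v : E) : T v = ∑ i, b.repr v i * T (b i) := by
  calc T v = T (∑ i, b.repr v i • b i) := by rw [b.sum_repr]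
    _ = _ := by simp only [map_sum, map_smul, smul_eq_mul]

/-- `1 + ∑ i, (ℓ (Ad q bᵢ))²`, for a linear form `ℓ` and a basis `b` of the Lie algebra. -/
def adSquareSum {ι : Type*} [Fintype ι] (b : Module.Basis ι ℝ E) (ℓ : E →L[ℝ] ℝ) (q : G) : ℝ :=
  1 + ∑ i, (ℓ (lieAdModel E q (b i))) ^ 2

theorem adSquareSum_pos {ι : Type*} [Fintype ι] (b : Module.Basis ι ℝ E) (ℓ : E →L[ℝ] ℝ) (q : G) :
    0 < adSquareSum b ℓ q := by
  unfold adSquareSum; positivity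

section
variable [LieGroup 𝓘(ℝ, E) ∞ G] [FiniteDimensional ℝ E]

theorem exists_norm_modelBracket_le (y : E) :
    ∃ K : ℝ, 0 ≤ K ∧ ∀ x : E, ‖modelBracket E G x y‖ ≤ K * ‖x‖ := by
  have := FiniteDimensional.complete ℝ E
  let L : E →ₗ[ℝ] E := LieAlgebra.ad ℝ (GroupLieAlgebra 𝓘(ℝ, E) G) y
  let T : E →L[ℝ] E := LinearMap.toContinuousLinearMap L
  refine ⟨‖T‖, norm_nonneg _, fun x ↦ ?_⟩
  have h : modelBracket E G x y = -(T x) :=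
    (lie_skew (L := GroupLieAlgebra 𝓘(ℝ, E) G) x y).symm
  rw [h, norm_neg]
  exact T.le_opNorm x

theorem contMDiff_log_adSquareSum {ι : Type*} [Fintype ι] (b : Module.Basis ι ℝ E)
    (ℓ : E →L[ℝ] ℝ) :
    ContMDiff 𝓘(ℝ, E) 𝓘(ℝ, ℝ) 1 (fun q : G ↦ Real.log (adSquareSum b ℓ q)) := by
  have := FiniteDimensional.complete ℝ E
  have h1 (i : ι) : ContMDiff 𝓘(ℝ, E) 𝓘(ℝ, ℝ) 1 (fun q : G ↦ ℓ (lieAdModel E q (b i))) :=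
    ℓ.contMDiff.comp ((contMDiff_lieAdModel (b i)).of_le (by norm_num))
  have h2 : ContMDiff 𝓘(ℝ, E) 𝓘(ℝ, ι → ℝ) 1 (fun (q : G) i ↦ ℓ (lieAdModel E q (b i))) :=
    contMDiff_pi_space.2 h1
  have h3 : ContDiff ℝ 1 (fun u : ι → ℝ ↦ Real.log (1 + ∑ i, u i ^ 2)) := by
    apply ContDiff.log
    · fun_prop
    · intro u; positivity
  exact h3.contMDiff.comp h2

/-- With fᵢ = ℓ(Ad_q bᵢ), expanding [x, bᵢ] in the basis writes fᵢ' as a combination of the fⱼ with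
coefficients linear in x and independent of q. The numerator is thus quadratic in f and controlled
by the sum in the denominator. -/
theorem exists_abs_deriv_log_adSquareSum_le {ι : Type*} [Fintype ι] (b : Module.Basis ι ℝ E)
    (ℓ : E →L[ℝ] ℝ) :
    ∃ K : ℝ, 0 ≤ K ∧ ∀ (q : G) (x : E) (f' : ι → ℝ),
      (∀ i, f' i = ℓ (lieAdModel E q (modelBracket E G x (b i)))) →
      |(∑ i, 2 * ℓ (lieAdModel E q (b i)) * f' i) / adSquareSum b ℓ q| ≤ K * ‖x‖ := by
  choose k hk0 hk using fun i ↦ exists_norm_modelBracket_le (G := G) (b i)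
  let c (j : ι) : E →L[ℝ] ℝ := LinearMap.toContinuousLinearMap (b.coord j)
  refine ⟨∑ i, ∑ j, 2 * (‖c j‖ * k i), Finset.sum_nonneg fun i _ ↦ Finset.sum_nonneg fun j _ ↦
    mul_nonneg zero_le_two (mul_nonneg (norm_nonneg _) (hk0 i)), fun q x f' hf' ↦ ?_⟩
  set f : ι → ℝ := fun i ↦ ℓ (lieAdModel E q (b i)) with hf
  set S := adSquareSum b ℓ q with hS
  have hSpos : 0 < S := adSquareSum_pos b ℓ q
  have hle (i : ι) : f i ^ 2 ≤ S := by
    have := Finset.single_le_sum (f := fun i ↦ f i ^ 2) (fun i _ ↦ sq_nonneg _)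
      (Finset.mem_univ i)
    have h : S = 1 + ∑ i, f i ^ 2 := rfl
    linarith
  have hprod (i j : ι) : |f i| * |f j| ≤ S := by
    -- By the arithmetic-geometric mean inequality, |fᵢ||fⱼ| ≤ (fᵢ² + fⱼ²)/2 ≤ S.
    nlinarith [hle i, hle j, sq_nonneg (|f i| - |f j|), sq_abs (f i), sq_abs (f j)]
  have hexp (i : ι) : f' i = ∑ j, c j (modelBracket E G x (b i)) * f j := by
    rw [hf' i]
    exact b.apply_eq_sum_repr_mul (ℓ.comp (lieAdModel E q)) _
  rw [abs_div, abs_of_pos hSpos, div_le_iff₀ hSpos]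
  calc |∑ i, 2 * f i * f' i| ≤ ∑ i, |2 * f i * f' i| := Finset.abs_sum_le_sum_abs _ _
    _ ≤ ∑ i, ∑ j, 2 * (‖c j‖ * k i) * (‖x‖ * S) := by
      refine Finset.sum_le_sum fun i _ ↦ ?_
      rw [hexp, Finset.mul_sum]
      refine (Finset.abs_sum_le_sum_abs _ _).trans (Finset.sum_le_sum fun j _ ↦ ?_)
      have h1 : |c j (modelBracket E G x (b i))| ≤ ‖c j‖ * (k i * ‖x‖) :=
        ((c j).le_opNorm _).trans (mul_le_mul_of_nonneg_left (hk i x) (norm_nonneg _))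
      calc |2 * f i * (c j (modelBracket E G x (b i)) * f j)|
          = 2 * |c j (modelBracket E G x (b i))| * (|f i| * |f j|) := by
            simp only [abs_mul, abs_two]; ring
        _ ≤ 2 * (‖c j‖ * (k i * ‖x‖)) * S := by
            have := hk0 i
            gcongr
            exact hprod i j
        _ = _ := by ring
    _ = (∑ i, ∑ j, 2 * (‖c j‖ * k i)) * ‖x‖ * S := by
      simp only [Finset.sum_mul, mul_assoc]

variable [T2Space G]

/-- The curve t ↦ q exp(tx) passes through q with the velocity of the left-invariant field of x, and
Ad_{q exp(tx)} = Ad_q Ad_{exp(tx)} gives the derivative of each term. -/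
theorem exists_abs_mfderiv_log_adSquareSum_le {ι : Type*} [Fintype ι] (b : Module.Basis ι ℝ E)
    (ℓ : E →L[ℝ] ℝ) :
    ∃ K : ℝ, 0 ≤ K ∧ ∀ (q : G) (D : E →L[ℝ] ℝ),
      HasMFDerivAt 𝓘(ℝ, E) 𝓘(ℝ, ℝ) (fun q : G ↦ Real.log (adSquareSum b ℓ q)) q D →
      ∀ x : E, |D (mulInvariantVectorField (I := 𝓘(ℝ, E)) x q)| ≤ K * ‖x‖ := by
  have := FiniteDimensional.complete ℝ E
  obtain ⟨K, hK0, hK⟩ := exists_abs_deriv_log_adSquareSum_le (G := G) b ℓ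
  refine ⟨K, hK0, fun q D hD x ↦ ?_⟩
  obtain ⟨p, hp⟩ := exists_isExpCurve (E := E) (G := G) x
  refine le_of_eq_of_le (congrArg abs ?_)
    (hK q x (fun i ↦ ℓ (lieAdModel E q (modelBracket E G x (b i)))) fun i ↦ rfl)
  let X : E := mulInvariantVectorField (I := 𝓘(ℝ, E)) x q
  have h1 : HasMFDerivAt 𝓘(ℝ, ℝ) 𝓘(ℝ, E) (fun t ↦ q * p t) 0 ((1 : ℝ →L[ℝ] ℝ).smulRight X) := by
    have h := (hp.2.isMIntegralCurveOn Set.univ).const_mul q 0 (Set.mem_univ _)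
    have h' := h.hasMFDerivAt Filter.univ_mem
    -- The base point q * p 0 equals q only propositionally, so the tangent vector is transported
    -- along that equality.
    have hX : ∀ r : G, r = q → (mulInvariantVectorField (I := 𝓘(ℝ, E)) x r : E) = X := by
      rintro r rfl; rfl
    have h2 : ((1 : ℝ →L[ℝ] ℝ).smulRight
      (mulInvariantVectorField (I := 𝓘(ℝ, E)) x (q * p 0) : E)) =
      (1 : ℝ →L[ℝ] ℝ).smulRight X := by
      exact congrArg ((1 : ℝ →L[ℝ] ℝ).smulRight ·) (hX _ (by rw [hp.1, mul_one]))
    exact h2 ▸ h'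
  have h2 : HasFDerivAt (fun t ↦ Real.log (adSquareSum b ℓ (q * p t)))
      (D.comp ((1 : ℝ →L[ℝ] ℝ).smulRight X)) 0 :=
    hasMFDerivAt_iff_hasFDerivAt.1 (HasMFDerivAt.comp_of_eq_point hD h1 (by simp [hp.1]))
  have h3 : HasDerivAt (fun t ↦ Real.log (adSquareSum b ℓ (q * p t))) (D X) 0 := by
    simpa using h2.hasDerivAt
  have h4 (i : ι) : HasDerivAt (fun t ↦ ℓ (lieAdModel E (q * p t) (b i)))
      (ℓ (lieAdModel E q (modelBracket E G x (b i)))) 0 := by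
    have h := ((ℓ.comp (lieAdModel E q)).hasFDerivAt).comp_hasDerivAt (0 : ℝ)
      (hasDerivAt_lieAdModel_expCurve hp (b i) 0)
    have h5 : lieAdModel E (p 0) (modelBracket E G x (b i)) = modelBracket E G x (b i) := by
      rw [hp.1]; exact lieAd_one _
    rw [h5] at h
    simp only [lieAdModel_mul]
    exact h
  have h5 : HasDerivAt (fun t ↦ adSquareSum b ℓ (q * p t))
      (∑ i, 2 * ℓ (lieAdModel E q (b i)) *
        ℓ (lieAdModel E q (modelBracket E G x (b i)))) 0 := by
    have h := (HasDerivAt.fun_sum (u := Finset.univ) fun i _ ↦ (h4 i).fun_pow 2).const_add 1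
    refine h.congr_deriv ?_
    simp [hp.1]
  have h6 := h5.log (adSquareSum_pos b ℓ _).ne'
  simp only [hp.1, mul_one] at h6
  exact h3.unique h6

/-- A function Lipschitz for d_R that grows linearly along p forces d_R(1, p(t)) to grow at least
linearly. -/
theorem tendsto_riemDist_of_eigenvector (gR : SmoothRiemannianMetric E G)
    (hgR : IsLeftInvariantForm gR.inner) {x y : E} {p : ℝ → G} (hp : IsExpCurve (E := E) x p)
    (hy0 : y ≠ 0) (hy : modelBracket E G x y = y) :
    Tendsto (fun t ↦ (riemDist gR 1 (p t)).toReal) atTop atTop := by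
  have := FiniteDimensional.complete ℝ E
  obtain ⟨ℓ, hℓ⟩ := SeparatingDual.exists_ne_zero (R := ℝ) hy0
  let b := Module.finBasis ℝ E
  obtain ⟨K, hK0, hK⟩ := exists_abs_mfderiv_log_adSquareSum_le (G := G) b ℓ
  obtain ⟨N, hN0, hN⟩ := exists_norm_le_normAtOne gR
  set h : G → ℝ := fun q ↦ Real.log (adSquareSum b ℓ q) with hh
  -- The summand 1 makes the Lipschitz constant positive even if K * N vanishes.
  have hC : 0 < K * N + 1 := by positivity
  have hlip (t : ℝ) : |h (p t) - h 1| ≤ (K * N + 1) * (riemDist gR 1 (p t)).toReal := by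
    refine abs_sub_le_mul_riemDist gR (contMDiff_log_adSquareSum b ℓ) hC ?_ ?_
    · intro q D hD v
      obtain ⟨ξ, rfl⟩ := exists_mulInvariantVectorField_eq (E := E) q v
      refine (hK q D hD ξ).trans ?_
      have h1 := hgR.apply_mulInvariantVectorField q ξ ξ
      have h2 : √((gR.inner q : E →L[ℝ] E →L[ℝ] ℝ) (mulInvariantVectorField ξ q : E)
          (mulInvariantVectorField ξ q : E)) = normAtOne gR ξ := congrArg Real.sqrt h1
      rw [h2]
      have h3 := normAtOne_nonneg gR ξ
      refine le_trans (b := K * (N * normAtOne gR ξ))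
        (mul_le_mul_of_nonneg_left (hN ξ) hK0) (by nlinarith)
    · have := riemDist_expCurve_ne_top gR hgR hp 0 t
      rwa [hp.1] at this
  set Q := ∑ i, (b.repr y i) ^ 2 with hQ
  -- Expand ℓ(Ad_{p(t)} y) = eᵗ ℓ(y) in the basis and apply Cauchy–Schwarz; the logarithm then
  -- yields the slope 2.
  have hgrow (t : ℝ) : (Real.exp t * ℓ y) ^ 2 ≤ (1 + Q) * adSquareSum b ℓ (p t) := by
    have h1 : Real.exp t * ℓ y = ∑ i, b.repr y i * ℓ (lieAdModel E (p t) (b i)) := by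
      have h2 : ℓ (lieAdModel E (p t) y) = Real.exp t * ℓ y := by
        rw [lieAdModel_expCurve_of_eigenvector hp hy, map_smul, smul_eq_mul]
      rw [← h2]
      exact b.apply_eq_sum_repr_mul (ℓ.comp (lieAdModel E (p t))) y
    rw [h1]
    refine (Finset.sum_mul_sq_le_sq_mul_sq _ _ _).trans ?_
    have hQ0 : 0 ≤ Q := by positivity
    apply mul_le_mul <;> first | positivity | skip
    · linarith
    · unfold adSquareSum; linarith
  have hQ1 : 0 < 1 + Q := by positivity
  have hlog (t : ℝ) : 2 * t + (Real.log ((ℓ y) ^ 2) - Real.log (1 + Q)) ≤ h (p t) := by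
    have h1 := Real.log_le_log (by positivity) (hgrow t)
    rw [mul_pow, Real.log_mul (by positivity) (by positivity),
      Real.log_mul hQ1.ne' (adSquareSum_pos b ℓ _).ne', Real.log_pow, Real.log_exp] at h1
    push_cast at h1
    simp only [hh]
    linarith
  refine tendsto_atTop_mono (f := fun t ↦
    (K * N + 1)⁻¹ * (2 * t + (Real.log ((ℓ y) ^ 2) - Real.log (1 + Q) - h 1))) (fun t ↦ ?_) ?_
  · rw [inv_mul_le_iff₀ hC]
    have := (le_abs_self _).trans (hlip t)
    linarith [hlog t]
  · exact (tendsto_atTop_add_const_right _ _ (tendsto_id.const_mul_atTop two_pos)).const_mul_atTop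
      (inv_pos.2 hC)

end

/-! ### The eigenvalue 1 and the main theorem -/

theorem SemiRiemannianMetric.hasEigenvalue_one_of_isEulerArnoldIdempotent
    [LieGroup 𝓘(ℝ, E) ∞ G] [FiniteDimensional ℝ E] (g : SemiRiemannianMetric E G)
    {x : GroupLieAlgebra 𝓘(ℝ, E) G} (hx : g.IsEulerArnoldIdempotent x) :
    (LieAlgebra.ad ℝ (GroupLieAlgebra 𝓘(ℝ, E) G) x).HasEigenvalue 1 := by
  set A := LieAlgebra.ad ℝ (GroupLieAlgebra 𝓘(ℝ, E) G) x with hA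
  rw [Module.End.hasEigenvalue_iff, Module.End.eigenspace_def]
  intro hker
  have hsurj := LinearMap.injective_iff_surjective.1 (LinearMap.ker_eq_bot.1 hker)
  -- If ad x - 1 were onto, every v would be [x, w] - w, and the idempotent equation makes x
  -- orthogonal to all of these.
  refine hx.1 (g.nondegenerate 1 x fun v ↦ ?_)
  obtain ⟨w, rfl⟩ := hsurj v
  have h := g.inner_adDagger x x w
  rw [hx.2] at h
  have h2 : (A - (1 : ℝ) • (1 : Module.End ℝ (GroupLieAlgebra 𝓘(ℝ, E) G))) w = ⁅x, w⁆ - w := by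
    simp [hA]
  rw [h2, map_sub, ← h, sub_self]

end

theorem proposition5
    {E : Type*} [NormedAddCommGroup E] [NormedSpace ℝ E] [FiniteDimensional ℝ E]
    {G : Type*} [TopologicalSpace G] [T2Space G] [ChartedSpace E G] [Group G]
    [LieGroup 𝓘(ℝ, E) ∞ G]
    (g : SemiRiemannianMetric E G) (hg : IsLeftInvariantForm g.inner)
    (x₀ : GroupLieAlgebra 𝓘(ℝ, E) G) (hx₀ : g.IsEulerArnoldIdempotent x₀) :
    -- `ad x₀` has the eigenvalue `1`
    (LieAlgebra.ad ℝ (GroupLieAlgebra 𝓘(ℝ, E) G) x₀).HasEigenvalue 1 ∧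
    -- the curve `p t = exp (t x₀)`
    ∃ p : ℝ → G, IsExpCurve x₀ p ∧
      ∀ gR : SmoothRiemannianMetric E G, IsLeftInvariantForm gR.inner →
        -- it goes to infinity, at finite distances from `1`
        (∀ t : ℝ, riemDist gR 1 (p t) ≠ ⊤) ∧
        Tendsto (fun t ↦ (riemDist gR 1 (p t)).toReal) atTop atTop ∧
        -- exponential growth of `Ad` along it
        ∀ y₀ : GroupLieAlgebra 𝓘(ℝ, E) G, ⁅x₀, y₀⁆ = y₀ → ∀ t : ℝ, 0 ≤ t →
          Real.exp ((riemDist gR 1 (p t)).toReal / normAtOne gR x₀) * normAtOne gR y₀ ≤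
            normAtOne gR (lieAd (E := E) (p t) y₀) := by
  have := FiniteDimensional.complete ℝ E
  have hev := SemiRiemannianMetric.hasEigenvalue_one_of_isEulerArnoldIdempotent g hx₀
  refine ⟨hev, ?_⟩
  obtain ⟨p, hp⟩ := exists_isExpCurve x₀
  refine ⟨p, hp, fun gR hgR ↦ ⟨fun t ↦ ?_, ?_, fun y₀ hy₀ t ht ↦ ?_⟩⟩
  · rw [← hp.1]
    exact riemDist_expCurve_ne_top gR hgR hp 0 t
  · obtain ⟨y, hy⟩ := hev.exists_hasEigenvector
    have hy1 : ⁅x₀, y⁆ = y := by simpa using hy.apply_eq_smul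
    exact tendsto_riemDist_of_eigenvector gR hgR hp hy.2 hy1
  · have hAd : lieAd (E := E) (p t) y₀ = Real.exp t • y₀ :=
      lieAdModel_expCurve_of_eigenvector hp hy₀ t
    rw [hAd, normAtOne_smul, abs_of_pos (Real.exp_pos t)]
    -- It remains to compare exponents: d_R(1, p(t)) / ‖x₀‖ ≤ t, the length bound for the curve
    -- itself.
    refine mul_le_mul_of_nonneg_right (Real.exp_le_exp.2 ?_) (normAtOne_nonneg gR y₀)
    rw [div_le_iff₀ (normAtOne_pos gR hx₀.1)]
    have h := riemDist_expCurve_le gR hgR hp ht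
    rw [hp.1, sub_zero] at h
    exact ENNReal.toReal_le_of_le_ofReal (mul_nonneg ht (normAtOne_nonneg gR x₀)) h
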